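/- Fix an acceptable recursive enumeration $(\varphi_n)_{n\in\mathbb N}$ of the partial recursive functions in one variable (that is, $(n,m)\mapsto\varphi_n(m)$ is partial recursive, every partial recursive function of one variable is some $\varphi_n$, and the s-m-n property holds: for every partial recursive $g(n,m)$ there is a total recursive $s$ with $\varphi_{s(n)}=g(n,\cdot)$ for all $n$). Let $\Psi:\mathbb N^3\to\{0,1\}$ be any runtime function for it: $\Psi$ is total recursive, $\Psi(n,m,k)=1$ implies $\Psi(n,m,k+1)=1$, $\Psi(n,m,k)=1$ for some $k$ if $\varphi_n(m)$ is defined, and $\Psi(n,m,k)=0$ for all $k$ otherwise. Let $A_T=\{n:\forall m\,\exists k\ \Psi(n,m,k)=1\}$ be the totality set, which is $\{n:\varphi_n\text{ is total}\}$. Let $\langle m_1,m_2\rangle=m_2+\tfrac12(m_1+m_2)(m_1+m_2+1)$. The number $\langle s,\langle a,b\rangle\rangle$ denotes the rational number $(-1)^s\frac{a}{1+b}$. A number $l=\langle k,c\rangle$ denotes the sequence $(a_m)_{m\in\mathbb N}$ of real numbers if $\varphi_k$ and $\varphi_c$ are total, and, with $r_{m,s}$ the rational number denoted by $\varphi_k(\langle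 m,s\rangle)$, we have $|a_m-r_{m,s}|<2^{-M}$ for all $m,M,s$ with $s\ge\varphi_c(\langle m,M\rangle)$. A real sequence is a computable sequence of computable numbers if some $l$ denotes it; a complex sequence is one if its real and imaginary parts are. For $\sigma\ge0$ let $\mathcal E_\sigma$ be the set of entire functions $f$ such that for every $\epsilon>0$ there is a constant $C(\epsilon)$ with $|f(z)|\le C(\epsilon)e^{(\sigma+\epsilon)|z|}$ for all $z\in\mathbb C$, and let $\mathrm{bw}(f)=\min\{\sigma\ge0:f\in\mathcal E_\sigma\}$. Let $\mathcal{CE}_\pi$ be the set of $f\in\mathcal E_\pi$ for which $(f^{(m)}(0))_{m\in\mathbb N}$ is a computable sequence of computable numbers. Let $\mathrm{SG}$ map $(a_m)_{m\in\mathbb N}$ to $f(z)=\sum_{m\ge0}\frac{a_m}{m!}z^m$. Let $O_b$ be the device deciding whether $\mathrm{bw}(f)<\tfrac12$, with output $O_b(f)=0$ if $\mathrm{bw}(f)<\tfrac12$ and $O_b(f)=1$ otherwise. Theorem. There is a Turing machine $\mathrm{TM}$ (a total recursive function) which, for each $n\in\mathbb N$, computes from $n$ a number $\mathrm{TM}(n)$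 denoting a computable sequence $(a_m)_{m\in\mathbb N}$ of computable real numbers, such that the series defining $f_n:=\mathrm{SG}((a_m)_m)$ converges on all of $\mathbb C$, $f_n\in\mathcal{CE}_\pi$, $\mathrm{bw}(f_n)=1$ if $\varphi_n$ is total, and $\mathrm{bw}(f_n)=0$ otherwise. Hence the device deciding whether $\mathrm{bw}(f)<\tfrac12$ solves the totality problem: $$O_b(\mathrm{SG}(\mathrm{TM}(n)))=\mathbf 1_{A_T}(n)\qquad\text{for all }n\in\mathbb N.$$ Equivalently, with the opposite labelling of its outputs ($1$ if $\mathrm{bw}(f)<\tfrac12$, and $0$ otherwise), the device returns $1-\mathbf 1_{A_T}(n)$ on $\mathrm{SG}(\mathrm{TM}(n))$. -/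

import Mathlib

namespace BandwidthOracle

/-! ### Enumerations of the recursive functions, runtime functions, totality set -/

/-- An acceptable recursive enumeration `φ₀, φ₁, …` of the recursive functions in one variable,
given by its universal function `Φ (n, m) = φₙ(m)`: the function `Φ` is recursive, every recursive
function in one variable is some `φₙ`, and the s-m-n property holds (a program for a function of
two variables can be specialised effectively in its first argument). -/
structure IsAcceptableEnumeration (Φ : ℕ → ℕ →. ℕ) : Prop where
  partrec : Partrec₂ Φ
  universal : ∀ g : ℕ →. ℕ, Nat.Partrec g → ∃ n, Φ n = g
  smn : ∀ g : ℕ → ℕ →. ℕ, Partrec₂ g → ∃ s : ℕ → ℕ, Computable s ∧ ∀ n, Φ (s n) = g n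

/-- `Ψ` is a (total recursive, `{0,1}`-valued) runtime function for `Φ`. -/
structure IsRuntimeFunction (Φ : ℕ → ℕ →. ℕ) (Ψ : ℕ → ℕ → ℕ → ℕ) : Prop where
  computable : Computable fun p : ℕ × ℕ × ℕ => Ψ p.1 p.2.1 p.2.2
  zero_or_one : ∀ n m k, Ψ n m k = 0 ∨ Ψ n m k = 1
  mono : ∀ n m k, Ψ n m k = 1 → Ψ n m (k + 1) = 1
  of_dom : ∀ n m, (Φ n m).Dom → ∃ k, Ψ n m k = 1
  of_not_dom : ∀ n m, ¬ (Φ n m).Dom → ∀ k, Ψ n m k = 0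

/-- The totality set attached to a runtime function. -/
def totalitySet (Ψ : ℕ → ℕ → ℕ → ℕ) : Set ℕ := {n | ∀ m, ∃ k, Ψ n m k = 1}

/-- The totality oracle `n ↦ 1_{A_T}(n)`. -/
noncomputable def totalityOracle (Ψ : ℕ → ℕ → ℕ → ℕ) : ℕ → ℕ :=
  (totalitySet Ψ).indicator 1

/-! ### Notations for rational numbers and for computable sequences of computable numbers -/

/-- The Cantor pairing function. -/
def cantorPair (a b : ℕ) : ℕ := b + (a + b) * (a + b + 1) / 2

/-- The number `m = ⟨s, a, b⟩` denotes the rational number `(-1)^s * a / (1 + b)`. -/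
def DenotesRat (m : ℕ) (q : ℚ) : Prop :=
  ∃ s a b : ℕ, m = cantorPair s (cantorPair a b) ∧ q = (-1) ^ s * ((a : ℚ) / (1 + (b : ℚ)))

/-- The index `k` denotes the computable double sequence `r` of rational numbers:
`φ_k(⟨m, s⟩)` is defined and denotes `r m s`, for all `m` and `s`. -/
def DenotesRatDoubleSeq (Φ : ℕ → ℕ →. ℕ) (k : ℕ) (r : ℕ → ℕ → ℚ) : Prop :=
  ∀ m s, ∃ v ∈ Φ k (cantorPair m s), DenotesRat v (r m s)

/-- The number `l = ⟨k, c⟩` denotes the computable sequence `x` of computable real numbers: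
`φ_k` describes a computable double sequence `r` of rational numbers, `ξ = φ_c` is total, and
`|x m - r m s| < 2^(-M)` whenever `s ≥ ξ(⟨m, M⟩)`. -/
def DenotesRealSeq (Φ : ℕ → ℕ →. ℕ) (l : ℕ) (x : ℕ → ℝ) : Prop :=
  ∃ (k c : ℕ) (r : ℕ → ℕ → ℚ) (ξ : ℕ → ℕ),
    l = cantorPair k c ∧ DenotesRatDoubleSeq Φ k r ∧ (∀ j, ξ j ∈ Φ c j) ∧
      ∀ m M s, ξ (cantorPair m M) ≤ s → |x m - (r m s : ℝ)| < 1 / 2 ^ M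

/-- A computable sequence of computable real numbers. -/
def IsComputableRealSeq (Φ : ℕ → ℕ →. ℕ) (x : ℕ → ℝ) : Prop :=
  ∃ l, DenotesRealSeq Φ l x

/-- A computable sequence of computable complex numbers. -/
def IsComputableComplexSeq (Φ : ℕ → ℕ →. ℕ) (a : ℕ → ℂ) : Prop :=
  IsComputableRealSeq Φ (fun n => (a n).re) ∧ IsComputableRealSeq Φ (fun n => (a n).im)

/-! ### Bandlimited signals -/

/-- The set `𝓔_σ` of entire functions that are bandlimited with bandwidth `σ ≥ 0`. -/
def bandlimited (σ : ℝ) : Set (ℂ → ℂ) :=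
  {f | 0 ≤ σ ∧ Differentiable ℂ f ∧
    ∀ ε > 0, ∃ C : ℝ, ∀ z : ℂ, ‖f z‖ ≤ C * Real.exp ((σ + ε) * ‖z‖)}

/-- The actual bandwidth; it is a minimum for every bandlimited signal, see `bw_isLeast`. -/
noncomputable def bw (f : ℂ → ℂ) : ℝ := sInf {σ : ℝ | f ∈ bandlimited σ}

theorem bw_isLeast {f : ℂ → ℂ} {σ : ℝ} (hf : f ∈ bandlimited σ) :
    IsLeast {σ : ℝ | f ∈ bandlimited σ} (bw f) := by
  have hne : {σ : ℝ | f ∈ bandlimited σ}.Nonempty := ⟨σ, hf⟩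
  have hbdd : BddBelow {σ : ℝ | f ∈ bandlimited σ} := ⟨0, fun τ hτ => hτ.1⟩
  refine ⟨⟨le_csInf hne fun τ hτ => hτ.1, hf.2.1, fun ε hε => ?_⟩, fun τ hτ => csInf_le hbdd hτ⟩
  obtain ⟨τ, hτ, hlt⟩ := exists_lt_of_csInf_lt hne (lt_add_of_pos_right (bw f) (half_pos hε))
  obtain ⟨C, hC⟩ := hτ.2.2 (ε / 2) (half_pos hε)
  refine ⟨C, fun z => (hC z).trans ?_⟩
  have hC0 : 0 ≤ C := by
    have h := (norm_nonneg _).trans (hC 0)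
    simpa using h
  have hexp : (τ + ε / 2) * ‖z‖ ≤ (bw f + ε) * ‖z‖ :=
    mul_le_mul_of_nonneg_right (by linarith) (norm_nonneg z)
  exact mul_le_mul_of_nonneg_left (Real.exp_le_exp.2 hexp) hC0

/-- The set `𝓒𝓔_π` of computable bandlimited signals: the derivatives `f⁽ⁿ⁾(0)` form a
computable sequence of computable numbers. -/
def computableBandlimited (Φ : ℕ → ℕ →. ℕ) : Set (ℂ → ℂ) :=
  {f | f ∈ bandlimited Real.pi ∧ IsComputableComplexSeq Φ (fun n => iteratedDeriv n f 0)}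

/-- The signal generator `SG`, mapping `(a_n)` to the signal `f(z) = ∑ a_n z^n / n!`. -/
noncomputable def signalGenerator (a : ℕ → ℝ) (z : ℂ) : ℂ :=
  ∑' n : ℕ, (a n : ℂ) / (n.factorial : ℂ) * z ^ n

/-- The device `O_b` deciding whether the bandwidth is smaller than `1/2`, with the outputs labelled
`0` for "smaller than `1/2`" and `1` for "at least `1/2`". -/
noncomputable def deviceOb (f : ℂ → ℂ) : ℕ := if bw f < 1 / 2 then 0 else 1

/-- The same decision device with the opposite labelling of its outputs: `1` for
"smaller than `1/2`" and `0` for "at least `1/2`". -/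
noncomputable def deviceObOpposite (f : ℂ → ℂ) : ℕ := if bw f < 1 / 2 then 1 else 0

end BandwidthOracle

/-! Run the computations of `Φ n` on 0, 1, 2, … in turn, moving to the next argument when the
current one is seen to halt, and let `a j` be 1 if a move happens at time `j` and 0 otherwise. If `Φ
n` is total there are infinitely many moves; otherwise the search is stuck forever at the first
divergent argument and `a` is eventually 0. The signal with Taylor derivatives `a` is thus a
polynomial, of bandwidth 0, in the second case. In the first, `|a j| ≤ 1` gives bandwidth at most 1,
and Cauchy's estimate (`tendsto_iteratedDeriv_of_mem_bandlimited`) excludes anything smaller, since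
`a` does not tend to 0. As `a` is computable uniformly in `n`, the s-m-n property produces its name
effectively. -/

namespace BandwidthOracle

/-! ### Decoding the Cantor pairing -/

/-- The sum of the two components of the pair with the given Cantor code. -/
def cantorSum (v : ℕ) : ℕ := Nat.findGreatest (fun t => t * (t + 1) / 2 ≤ v) v

/-- The first component of the pair with the given Cantor code. -/
def cantorFst (v : ℕ) : ℕ := cantorSum v - (v - cantorSum v * (cantorSum v + 1) / 2)

theorem triangle_succ (t : ℕ) : (t + 1) * (t + 1 + 1) / 2 = t * (t + 1) / 2 + (t + 1) := by
  rw [show (t + 1) * (t + 1 + 1) = t * (t + 1) + (t + 1) * 2 by ring,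
    Nat.add_mul_div_right _ _ two_pos]

theorem triangle_mono : Monotone fun t : ℕ => t * (t + 1) / 2 :=
  monotone_nat_of_le_succ fun t => by rw [triangle_succ]; exact Nat.le_add_right _ _

/-- This makes `v` a large enough search bound in `cantorSum`. -/
theorem le_triangle (t : ℕ) : t ≤ t * (t + 1) / 2 := by
  cases t with
  | zero => simp
  | succ t => rw [triangle_succ]; exact Nat.le_add_left _ _

theorem cantorSum_cantorPair (a b : ℕ) : cantorSum (cantorPair a b) = a + b := by
  rw [cantorSum, Nat.findGreatest_eq_iff]
  refine ⟨?_, fun _ => Nat.le_add_left _ _, fun {t} ht _ h => ?_⟩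
  · exact (le_triangle _).trans (Nat.le_add_left _ _)
  · have h1 : (a + b + 1) * (a + b + 1 + 1) / 2 ≤ t * (t + 1) / 2 := triangle_mono ht
    rw [triangle_succ] at h1
    have h2 : t * (t + 1) / 2 ≤ b + (a + b) * (a + b + 1) / 2 := h
    omega

theorem cantorFst_cantorPair (a b : ℕ) : cantorFst (cantorPair a b) = a := by
  rw [cantorFst, cantorSum_cantorPair, cantorPair]
  omega

theorem primrec_triangle : Primrec fun t : ℕ => t * (t + 1) / 2 :=
  Primrec.nat_div.comp (Primrec.nat_mul.comp Primrec.id Primrec.succ) (Primrec.const 2)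

theorem primrec_cantorSum : Primrec cantorSum :=
  Primrec.nat_findGreatest Primrec.id
    (Primrec.nat_le.comp (primrec_triangle.comp Primrec.snd) Primrec.fst)

theorem primrec_cantorFst : Primrec cantorFst :=
  Primrec.nat_sub.comp primrec_cantorSum
    (Primrec.nat_sub.comp Primrec.id (primrec_triangle.comp primrec_cantorSum))

theorem primrec_cantorPair : Primrec₂ cantorPair :=
  Primrec.nat_add.comp Primrec.snd
    (primrec_triangle.comp (Primrec.nat_add.comp Primrec.fst Primrec.snd))

/-! ### Dovetailing the computations `Φ n 0, Φ n 1, …` -/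

/-- The argument under test at time `j`: the test moves on to the next argument as soon as the
computation at the current one has halted. -/
def stage (Ψ : ℕ → ℕ → ℕ → ℕ) (n : ℕ) : ℕ → ℕ
  | 0 => 0
  | j + 1 => stage Ψ n j + Ψ n (stage Ψ n j) j

/-- The indicator of the times at which the argument under test changes. -/
def progress (Ψ : ℕ → ℕ → ℕ → ℕ) (n j : ℕ) : ℕ := Ψ n (stage Ψ n j) j

theorem computable_progress {Ψ : ℕ → ℕ → ℕ → ℕ}
    (h : Computable fun p : ℕ × ℕ × ℕ => Ψ p.1 p.2.1 p.2.2) : Computable₂ (progress Ψ) := by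
  have hs : Computable fun p : ℕ × ℕ => stage Ψ p.1 p.2 := by
    have hstep : Computable₂ fun (p : ℕ × ℕ) (q : ℕ × ℕ) => q.2 + Ψ p.1 q.2 q.1 := by
      have hq1 : Computable fun x : (ℕ × ℕ) × ℕ × ℕ => x.2.1 := Computable.fst.comp Computable.snd
      have hq2 : Computable fun x : (ℕ × ℕ) × ℕ × ℕ => x.2.2 := Computable.snd.comp Computable.snd
      have hp : Computable fun x : (ℕ × ℕ) × ℕ × ℕ => x.1.1 := Computable.fst.comp Computable.fst
      have hΨ : Computable fun x : (ℕ × ℕ) × ℕ × ℕ => Ψ x.1.1 x.2.2 x.2.1 :=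
        (h.comp (hp.pair (hq2.pair hq1))).of_eq fun _ => rfl
      exact Primrec.nat_add.to_comp.comp hq2 hΨ
    refine (Computable.nat_rec Computable.snd (Computable.const 0) hstep).of_eq fun p => ?_
    obtain ⟨n, j⟩ := p
    induction j with
    | zero => rfl
    | succ j ih => exact congrArg (fun c => c + Ψ n c j) ih
  exact (h.comp (Computable.fst.pair (hs.pair Computable.snd))).of_eq fun _ => rfl

section Progress

variable {Φ : ℕ → ℕ →. ℕ} {Ψ : ℕ → ℕ → ℕ → ℕ}

theorem IsRuntimeFunction.mono_le (hΨ : IsRuntimeFunction Φ Ψ) {n m k k' : ℕ} (hk : k ≤ k')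
    (h : Ψ n m k = 1) : Ψ n m k' = 1 := by
  induction hk with
  | refl => exact h
  | step _ ih => exact hΨ.mono _ _ _ ih

theorem IsRuntimeFunction.exists_eq_one_iff (hΨ : IsRuntimeFunction Φ Ψ) (n m : ℕ) :
    (∃ k, Ψ n m k = 1) ↔ (Φ n m).Dom := by
  refine ⟨fun ⟨k, hk⟩ => ?_, hΨ.of_dom n m⟩
  by_contra hd
  simp [hΨ.of_not_dom n m hd k] at hk

theorem IsRuntimeFunction.mem_totalitySet_iff (hΨ : IsRuntimeFunction Φ Ψ) (n : ℕ) :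
    n ∈ totalitySet Ψ ↔ ∀ m, (Φ n m).Dom :=
  forall_congr' (hΨ.exists_eq_one_iff n)

theorem IsRuntimeFunction.progress_eq_zero_or_one (hΨ : IsRuntimeFunction Φ Ψ) (n j : ℕ) :
    progress Ψ n j = 0 ∨ progress Ψ n j = 1 :=
  hΨ.zero_or_one _ _ _

/-- Without further moves the stage would be frozen at one argument; its computation halts, and
monotonicity of `Ψ` ensures that this is noticed at every late time. -/
theorem IsRuntimeFunction.frequently_progress (hΨ : IsRuntimeFunction Φ Ψ) {n : ℕ}
    (h : ∀ m, (Φ n m).Dom) (N : ℕ) : ∃ j ≥ N, progress Ψ n j = 1 := by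
  by_contra! hcon
  have hz : ∀ j ≥ N, progress Ψ n j = 0 := fun j hj =>
    (hΨ.progress_eq_zero_or_one n j).resolve_right (hcon j hj)
  have hc : ∀ j ≥ N, stage Ψ n j = stage Ψ n N := fun j hj => by
    induction j, hj using Nat.le_induction with
    | base => rfl
    | succ j hj ih => rw [← ih]; exact congrArg (stage Ψ n j + ·) (hz j hj)
  obtain ⟨k, hk⟩ := hΨ.of_dom n (stage Ψ n N) (h _)
  have h1 := hcon (max N k) (le_max_left _ _)
  rw [progress, hc _ (le_max_left _ _)] at h1
  exact h1 (hΨ.mono_le (le_max_right _ _) hk)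

/-- A divergent argument `m` is a barrier that the stage never passes, while each move raises the
stage by one. -/
theorem IsRuntimeFunction.eventually_progress_eq_zero (hΨ : IsRuntimeFunction Φ Ψ) {n : ℕ}
    (h : ¬ ∀ m, (Φ n m).Dom) : ∃ N, ∀ j ≥ N, progress Ψ n j = 0 := by
  obtain ⟨m, hm⟩ := not_forall.1 h
  have hle : ∀ j, stage Ψ n j ≤ m := fun j => by
    induction j with
    | zero => exact Nat.zero_le _
    | succ j ih =>
      rcases ih.eq_or_lt with he | hlt
      · rw [stage, he, hΨ.of_not_dom n m hm]
        exact le_rfl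
      · have := hΨ.zero_or_one n (stage Ψ n j) j
        rw [stage]
        omega
  by_contra! hcon
  have hunb : ∀ i, ∃ j, i ≤ stage Ψ n j := fun i => by
    induction i with
    | zero => exact ⟨0, Nat.zero_le _⟩
    | succ i ih =>
      obtain ⟨j, hj⟩ := ih
      obtain ⟨j', hj', hne⟩ := hcon j
      have hmono : stage Ψ n j ≤ stage Ψ n j' :=
        monotone_nat_of_le_succ (f := stage Ψ n) (fun _ => Nat.le_add_right _ _) hj'
      have h1 := (hΨ.progress_eq_zero_or_one n j').resolve_left hne
      refine ⟨j' + 1, ?_⟩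
      change i + 1 ≤ stage Ψ n j' + progress Ψ n j'
      omega
  obtain ⟨j, hj⟩ := hunb (m + 1)
  have := hle j
  omega

end Progress

/-! ### Names of `{0,1}`-valued sequences -/

/-- The codes of 0/1 and 1/1 with sign exponent 0 happen to be 0 and 2; the factor 2 is special to
these two values. -/
theorem denotesRat_two_mul {e : ℕ} (he : e = 0 ∨ e = 1) : DenotesRat (2 * e) (e : ℚ) := by
  refine ⟨0, e, 0, ?_, by simp⟩
  rcases he with rfl | rfl <;> rfl

/-- If `k` computes the doubled value of the first component and `c` is an index of the zero
function, then `⟨k, c⟩` denotes the sequence. -/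
theorem denotesRealSeq_of_zero_one {Φ : ℕ → ℕ →. ℕ} {k c : ℕ} {e : ℕ → ℕ}
    (he : ∀ m, e m = 0 ∨ e m = 1) (hk : ∀ v, 2 * e (cantorFst v) ∈ Φ k v)
    (hc : ∀ v, 0 ∈ Φ c v) : DenotesRealSeq Φ (cantorPair k c) fun m => (e m : ℝ) := by
  -- The approximations are exact at every `s`, so the zero modulus of convergence works.
  refine ⟨k, c, fun m _ => e m, fun _ => 0, rfl, fun m s => ⟨2 * e m, ?_, ?_⟩, hc, ?_⟩
  · simpa only [cantorFst_cantorPair] using hk (cantorPair m s)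
  · exact denotesRat_two_mul (he m)
  · intro m M s _
    simp

theorem IsAcceptableEnumeration.exists_denotesRealSeq {Φ : ℕ → ℕ →. ℕ}
    (hΦ : IsAcceptableEnumeration Φ) {e : ℕ → ℕ → ℕ} (hcomp : Computable₂ e)
    (he : ∀ n m, e n m = 0 ∨ e n m = 1) :
    ∃ T : ℕ → ℕ, Computable T ∧ ∀ n, DenotesRealSeq Φ (T n) fun m => (e n m : ℝ) := by
  obtain ⟨c, hc⟩ := hΦ.universal (fun _ => Part.some 0) (Partrec.nat_iff.1 (Computable.const 0))
  have hg : Computable₂ fun n v => 2 * e n (cantorFst v) :=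
    Primrec.nat_mul.to_comp.comp (Computable.const 2)
      (hcomp.comp Computable.fst (primrec_cantorFst.to_comp.comp Computable.snd))
  obtain ⟨s, hs, hΦs⟩ := hΦ.smn (fun n v => Part.some (2 * e n (cantorFst v))) hg.partrec₂
  refine ⟨fun n => cantorPair (s n) c, primrec_cantorPair.to_comp.comp hs (Computable.const c),
    fun n => denotesRealSeq_of_zero_one (he n) (fun v => ?_) fun v => ?_⟩
  · rw [hΦs]; exact Part.mem_some _
  · rw [hc]; exact Part.mem_some _

/-! ### Exponential type and Taylor coefficients -/

section Signal

variable {a : ℕ → ℝ}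

theorem norm_coeff_mul_pow_le (ha : ∀ m, |a m| ≤ 1) (z : ℂ) (m : ℕ) :
    ‖(a m : ℂ) / (m.factorial : ℂ) * z ^ m‖ ≤ ‖z‖ ^ m / m.factorial := by
  rw [norm_mul, norm_div, norm_pow, Complex.norm_real, Complex.norm_natCast, Real.norm_eq_abs,
    div_mul_eq_mul_div]
  gcongr
  exact mul_le_of_le_one_left (by positivity) (ha m)

theorem hasSum_signalGenerator (ha : ∀ m, |a m| ≤ 1) (z : ℂ) :
    HasSum (fun m : ℕ => (a m : ℂ) / (m.factorial : ℂ) * z ^ m) (signalGenerator a z) :=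
  (Summable.of_norm_bounded (Real.summable_pow_div_factorial ‖z‖)
    (norm_coeff_mul_pow_le ha z)).hasSum

theorem norm_signalGenerator_le (ha : ∀ m, |a m| ≤ 1) (z : ℂ) :
    ‖signalGenerator a z‖ ≤ Real.exp ‖z‖ := by
  have h : HasSum (fun m : ℕ => ‖z‖ ^ m / m.factorial) (Real.exp ‖z‖) := by
    rw [Real.exp_eq_exp_ℝ]
    exact NormedSpace.expSeries_div_hasSum_exp ‖z‖
  exact tsum_of_norm_bounded h (norm_coeff_mul_pow_le ha z)

theorem hasFPowerSeriesOnBall_signalGenerator (ha : ∀ m, |a m| ≤ 1) :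
    HasFPowerSeriesOnBall (signalGenerator a)
      (FormalMultilinearSeries.ofScalars ℂ fun m => (a m : ℂ) / (m.factorial : ℂ)) 0 ⊤ := by
  set p := FormalMultilinearSeries.ofScalars ℂ fun m => (a m : ℂ) / (m.factorial : ℂ) with hp
  have hr : p.radius = ⊤ := by
    refine p.radius_eq_top_of_summable_norm fun r => ?_
    refine Summable.of_nonneg_of_le (fun _ => by positivity) (fun m => ?_)
      (Real.summable_pow_div_factorial r)
    rw [hp, FormalMultilinearSeries.ofScalars_norm]
    have := norm_coeff_mul_pow_le ha (r : ℂ) m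
    simpa [norm_mul] using this
  have hsum : p.sum = signalGenerator a := by
    funext z
    rw [hp]
    exact (FormalMultilinearSeries.ofScalars_sum_eq _ _).trans
      (tsum_congr fun m => by rw [smul_eq_mul])
  rw [← hr, ← hsum]
  exact p.hasFPowerSeriesOnBall (by rw [hr]; exact ENNReal.zero_lt_top)

theorem differentiable_signalGenerator (ha : ∀ m, |a m| ≤ 1) :
    Differentiable ℂ (signalGenerator a) := by
  have h := (hasFPowerSeriesOnBall_signalGenerator ha).differentiableOn
  rwa [Metric.eball_top, differentiableOn_univ] at h

theorem iteratedDeriv_signalGenerator (ha : ∀ m, |a m| ≤ 1) (m : ℕ) :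
    iteratedDeriv m (signalGenerator a) 0 = a m := by
  have h := (hasFPowerSeriesOnBall_signalGenerator ha).factorial_smul 1 m
  rw [iteratedDeriv_eq_iteratedFDeriv, ← h, FormalMultilinearSeries.ofScalars_apply_eq, one_pow,
    smul_eq_mul, mul_one, nsmul_eq_mul,
    mul_div_cancel₀ _ (Nat.cast_ne_zero.2 m.factorial_ne_zero)]

theorem bandlimited_mono {σ τ : ℝ} (h : σ ≤ τ) : bandlimited σ ⊆ bandlimited τ := by
  rintro f ⟨h0, hd, hb⟩
  refine ⟨h0.trans h, hd, fun ε hε => ?_⟩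
  obtain ⟨C, hC⟩ := hb (ε + (τ - σ)) (by linarith)
  refine ⟨C, fun z => (hC z).trans_eq ?_⟩
  ring_nf

theorem signalGenerator_mem_bandlimited_one (ha : ∀ m, |a m| ≤ 1) :
    signalGenerator a ∈ bandlimited 1 := by
  refine ⟨zero_le_one, differentiable_signalGenerator ha, fun ε hε => ⟨1, fun z => ?_⟩⟩
  rw [one_mul]
  refine (norm_signalGenerator_le ha z).trans (Real.exp_le_exp.2 ?_)
  nlinarith [norm_nonneg z]

theorem bw_eq_zero_of_mem {f : ℂ → ℂ} (h : f ∈ bandlimited 0) : bw f = 0 :=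
  le_antisymm ((bw_isLeast h).2 h) (bw_isLeast h).1.1

theorem bw_signalGenerator_eq_zero (ha : ∀ m, |a m| ≤ 1) {N : ℕ} (hN : ∀ m ≥ N, a m = 0) :
    bw (signalGenerator a) = 0 := by
  -- The constant comes from `(ε‖z‖)^m / m! ≤ exp (ε‖z‖)`, applied to each of the finitely many
  -- terms.
  refine bw_eq_zero_of_mem ⟨le_rfl, differentiable_signalGenerator ha, fun ε hε =>
    ⟨∑ m ∈ Finset.range N, (ε ^ m)⁻¹, fun z => ?_⟩⟩
  have hsum : signalGenerator a z
      = ∑ m ∈ Finset.range N, (a m : ℂ) / (m.factorial : ℂ) * z ^ m :=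
    tsum_eq_sum fun m hm => by simp [hN m (by simpa using hm)]
  rw [hsum, Finset.sum_mul, zero_add]
  refine (norm_sum_le _ _).trans (Finset.sum_le_sum fun m _ => ?_)
  refine (norm_coeff_mul_pow_le ha z m).trans ?_
  rw [inv_mul_eq_div, le_div_iff₀ (pow_pos hε m)]
  calc ‖z‖ ^ m / m.factorial * ε ^ m = (ε * ‖z‖) ^ m / m.factorial := by ring
    _ ≤ Real.exp (ε * ‖z‖) := Real.pow_div_factorial_le_exp _ (by positivity) m

/-- A crude Stirling bound `k! e^k ≤ e k k^k` with `k = m + 1`; the induction step reduces to `e ≤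
(1 + 1/k)^(k+1)`. The extra factor `k` is harmless against geometric decay. -/
theorem factorial_mul_exp_le (m : ℕ) :
    ((m + 1).factorial : ℝ) * Real.exp (m + 1) ≤ Real.exp 1 * (m + 1) * (m + 1) ^ (m + 1) := by
  induction m with
  | zero => simp
  | succ m ih =>
    have hm : (0 : ℝ) < m + 1 := by positivity
    have key : Real.exp 1 * ((m : ℝ) + 1) ^ (m + 2) ≤ ((m : ℝ) + 2) ^ (m + 2) := by
      have hlog : 1 / ((m : ℝ) + 2) ≤ Real.log (((m : ℝ) + 2) / (m + 1)) := by
        refine le_trans (le_of_eq ?_) (Real.one_sub_inv_le_log_of_pos (by positivity))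
        field_simp
        ring
      have h1 : (1 : ℝ) ≤ ((m + 2 : ℕ) : ℝ) * Real.log (((m : ℝ) + 2) / (m + 1)) := by
        rw [div_le_iff₀ (by positivity)] at hlog
        push_cast
        linarith
      have h2 := Real.exp_le_exp.2 h1
      rw [Real.exp_nat_mul, Real.exp_log (by positivity), div_pow,
        le_div_iff₀ (by positivity)] at h2
      exact h2
    push_cast [Nat.factorial_succ (m + 1)] at ih ⊢
    have e1 : (m : ℝ) + 1 + 1 = m + 2 := by ring
    rw [e1, show (m : ℝ) + 2 = m + 1 + 1 by ring, Real.exp_add (m + 1 : ℝ) 1, e1]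
    calc ((m : ℝ) + 2) * ((m + 1).factorial : ℝ) * (Real.exp (m + 1) * Real.exp 1)
        = ((m : ℝ) + 2) * Real.exp 1 * (((m + 1).factorial : ℝ) * Real.exp (m + 1)) := by ring
      _ ≤ ((m : ℝ) + 2) * Real.exp 1 * (Real.exp 1 * (m + 1) * (m + 1) ^ (m + 1)) := by gcongr
      _ = Real.exp 1 * ((m : ℝ) + 2) * (Real.exp 1 * ((m : ℝ) + 1) ^ (m + 2)) := by ring
      _ ≤ Real.exp 1 * ((m : ℝ) + 2) * ((m : ℝ) + 2) ^ (m + 2) := by gcongr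

/-- A bandwidth smaller than `1` forces the derivatives at the origin to tend to zero. -/
theorem tendsto_iteratedDeriv_of_mem_bandlimited {f : ℂ → ℂ} {σ : ℝ} (hf : f ∈ bandlimited σ)
    (hσ : σ < 1) :
    Filter.Tendsto (fun m => iteratedDeriv m f 0) Filter.atTop (nhds 0) := by
  obtain ⟨C, hC⟩ := hf.2.2 ((1 - σ) / 2) (by linarith)
  -- The midpoint of `σ` and 1 leaves room for `ε` and still gives a ratio `q < 1`.
  set τ := σ + (1 - σ) / 2 with hτ
  have hτ1 : τ < 1 := by rw [hτ]; linarith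
  have hC0 : 0 ≤ C := by simpa using (norm_nonneg _).trans (hC 0)
  set q := Real.exp (τ - 1) with hq
  have hq1 : q < 1 := Real.exp_lt_one_iff.2 (by linarith)
  have hbound : ∀ m : ℕ, ‖iteratedDeriv (m + 1) f 0‖ ≤
      C * Real.exp 1 * (((m + 1 : ℕ) : ℝ) * q ^ (m + 1)) := fun m => by
    have hR : (0 : ℝ) < (m : ℝ) + 1 := by positivity
    -- Cauchy's estimate for the derivative of order `m + 1` on the circle of radius `m + 1`, close
    -- to optimal for exponential type near 1; the shift keeps the radius positive.
    have h := Complex.norm_iteratedDeriv_le_of_forall_mem_sphere_norm_le (f := f) (c := 0)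
      (C := C * Real.exp (τ * (m + 1))) (m + 1) hR hf.2.1.diffContOnCl fun z hz => by
        have := hC z
        rwa [mem_sphere_zero_iff_norm.1 hz] at this
    refine h.trans ?_
    rw [div_le_iff₀ (by positivity)]
    have hqe : q ^ (m + 1) * Real.exp (m + 1) = Real.exp (τ * (m + 1)) := by
      rw [hq, ← Real.exp_nat_mul, ← Real.exp_add]
      congr 1
      push_cast
      ring
    rw [← hqe]
    calc ((m + 1).factorial : ℝ) * (C * (q ^ (m + 1) * Real.exp (m + 1)))
        = C * q ^ (m + 1) * (((m + 1).factorial : ℝ) * Real.exp (m + 1)) := by ring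
      _ ≤ C * q ^ (m + 1) * (Real.exp 1 * (m + 1) * (m + 1) ^ (m + 1)) := by
          exact mul_le_mul_of_nonneg_left (factorial_mul_exp_le m)
            (mul_nonneg hC0 (pow_nonneg (Real.exp_pos _).le _))
      _ = C * Real.exp 1 * (((m + 1 : ℕ) : ℝ) * q ^ (m + 1)) * ((m : ℝ) + 1) ^ (m + 1) := by
          push_cast
          ring
  rw [← Filter.tendsto_add_atTop_iff_nat 1]
  refine squeeze_zero_norm hbound ?_
  have hlim := (Filter.tendsto_add_atTop_iff_nat 1).2
    (tendsto_self_mul_const_pow_of_lt_one (Real.exp_pos _).le hq1)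
  simpa using hlim.const_mul (C * Real.exp 1)

theorem bw_signalGenerator_eq_one (ha : ∀ m, |a m| ≤ 1) (h1 : ∀ N, ∃ m ≥ N, a m = 1) :
    bw (signalGenerator a) = 1 := by
  have hmem := signalGenerator_mem_bandlimited_one ha
  refine le_antisymm ((bw_isLeast hmem).2 hmem) (le_of_not_gt fun hlt => ?_)
  have hlim := tendsto_iteratedDeriv_of_mem_bandlimited (bw_isLeast hmem).1 hlt
  simp only [iteratedDeriv_signalGenerator ha] at hlim
  obtain ⟨N, hN⟩ := Metric.tendsto_atTop.1 hlim 1 one_pos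
  obtain ⟨m, hm, ham⟩ := h1 N
  simpa [ham] using hN m hm

theorem signalGenerator_mem_computableBandlimited {Φ : ℕ → ℕ →. ℕ} (ha : ∀ m, |a m| ≤ 1)
    (hcomp : IsComputableRealSeq Φ a) (hzero : IsComputableRealSeq Φ fun _ => 0) :
    signalGenerator a ∈ computableBandlimited Φ := by
  refine ⟨bandlimited_mono (by linarith [Real.pi_gt_three])
    (signalGenerator_mem_bandlimited_one ha), ?_⟩
  simp only [IsComputableComplexSeq, iteratedDeriv_signalGenerator ha, Complex.ofReal_re,
    Complex.ofReal_im]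
  exact ⟨hcomp, hzero⟩

end Signal

end BandwidthOracle

theorem mainTheorem8 (Φ : ℕ → ℕ →. ℕ) (hΦ : BandwidthOracle.IsAcceptableEnumeration Φ)
    (Ψ : ℕ → ℕ → ℕ → ℕ) (hΨ : BandwidthOracle.IsRuntimeFunction Φ Ψ) :
    ∃ TM : ℕ → ℕ, Computable TM ∧ ∀ n : ℕ, ∃ a : ℕ → ℝ,
      BandwidthOracle.DenotesRealSeq Φ (TM n) a ∧
      (∀ z : ℂ, HasSum (fun m : ℕ => (a m : ℂ) / (m.factorial : ℂ) * z ^ m)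
        (BandwidthOracle.signalGenerator a z)) ∧
      BandwidthOracle.signalGenerator a ∈ BandwidthOracle.computableBandlimited Φ ∧
      ((∀ m, (Φ n m).Dom) → BandwidthOracle.bw (BandwidthOracle.signalGenerator a) = 1) ∧
      ((¬ ∀ m, (Φ n m).Dom) → BandwidthOracle.bw (BandwidthOracle.signalGenerator a) = 0) ∧
      BandwidthOracle.deviceOb (BandwidthOracle.signalGenerator a) =
        BandwidthOracle.totalityOracle Ψ n ∧
      BandwidthOracle.deviceObOpposite (BandwidthOracle.signalGenerator a) =
        1 - BandwidthOracle.totalityOracle Ψ n := by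
  obtain ⟨T, hT, hden⟩ := hΦ.exists_denotesRealSeq
    (BandwidthOracle.computable_progress hΨ.computable) hΨ.progress_eq_zero_or_one
  -- A name for the zero sequence, needed for the imaginary parts of the derivatives.
  obtain ⟨T₀, -, hden₀⟩ := hΦ.exists_denotesRealSeq (e := fun _ _ => 0)
    (Computable.const 0) fun _ _ => Or.inl rfl
  refine ⟨T, hT, fun n => ?_⟩
  set a : ℕ → ℝ := fun m => (BandwidthOracle.progress Ψ n m : ℝ) with ha_def
  have ha : ∀ m, |a m| ≤ 1 := fun m => by
    rcases hΨ.progress_eq_zero_or_one n m with h | h <;> simp [ha_def, h]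
  have hone : (∀ m, (Φ n m).Dom) →
      BandwidthOracle.bw (BandwidthOracle.signalGenerator a) = 1 := fun h =>
    BandwidthOracle.bw_signalGenerator_eq_one ha fun N => by
      obtain ⟨j, hj, hj1⟩ := hΨ.frequently_progress h N
      exact ⟨j, hj, by simp [ha_def, hj1]⟩
  have hzero : (¬ ∀ m, (Φ n m).Dom) →
      BandwidthOracle.bw (BandwidthOracle.signalGenerator a) = 0 := fun h => by
    obtain ⟨N, hN⟩ := hΨ.eventually_progress_eq_zero h
    exact BandwidthOracle.bw_signalGenerator_eq_zero ha (N := N) fun m hm => by simp [ha_def, hN m hm]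
  have horacle : BandwidthOracle.totalityOracle Ψ n =
      if BandwidthOracle.bw (BandwidthOracle.signalGenerator a) < 1 / 2 then 0 else 1 := by
    rw [BandwidthOracle.totalityOracle]
    by_cases h : ∀ m, (Φ n m).Dom
    · rw [Set.indicator_of_mem ((hΨ.mem_totalitySet_iff n).2 h), hone h]
      norm_num
    · rw [Set.indicator_of_notMem (mt (hΨ.mem_totalitySet_iff n).1 h), hzero h]
      norm_num
  refine ⟨a, hden n, BandwidthOracle.hasSum_signalGenerator ha,
    BandwidthOracle.signalGenerator_mem_computableBandlimited ha ⟨_, hden n⟩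
      ⟨T₀ 0, by simpa using hden₀ 0⟩, hone, hzero, horacle.symm, ?_⟩
  rw [horacle, BandwidthOracle.deviceObOpposite]
  split_ifs <;> rfl
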